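/- Let $R$ be a ring with identity, not necessarily commutative, let $M_R$ be an injective right $R$-module, and let $S=\operatorname{End}(M_R)$, acting on $M$ from the left. Call an element $s$ of a ring $S$ right singular if its right annihilator $\{y\in S : sy=0\}$ is nonzero. If every right singular element of $S$ is a product of finitely many idempotents of $S$, then $S$ has stable range $1$: for all $a,b\in S$ with $aS+bS=S$ there is $y\in S$ such that $a+by$ is invertible in $S$. Moreover, for a vector space $V$ over a field $K$, every right singular element of $\operatorname{End}_K(V)$ is a product of finitely many projections (that is, idempotent endomorphisms of $V$) if and only if $V$ is finite-dimensional. -/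

import Mathlib

universe u v w x

/-- An element `a` of a ring is right singular if its right annihilator
`{y | a * y = 0}` is nonzero. -/
def IsRightSingular {S : Type*} [Ring S] (a : S) : Prop :=
  ∃ y : S, y ≠ 0 ∧ a * y = 0

/-- `a` is a product of finitely many idempotents. (Allowing the empty product changes nothing,
as its value `1` is idempotent.) -/
def IsProductOfIdempotents {S : Type*} [Ring S] (a : S) : Prop :=
  ∃ l : List S, (∀ e ∈ l, IsIdempotentElem e) ∧ l.prod = a

/-- `S` has stable range `1`: whenever `aS + bS = S`, that is, `a * c + b * d = 1` for some
`c` and `d`, there is `y` such that `a + b * y` is invertible. -/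
def HasStableRangeOne (S : Type*) [Ring S] : Prop :=
  ∀ a b : S, (∃ c d : S, a * c + b * d = 1) → ∃ y : S, IsUnit (a + b * y)

/-! ### Products of idempotents and direct finiteness. -/

section IdempotentProducts

/-! A product of idempotents with a right inverse is `1`. If xy = 1 ≠ yx, then x kills 1 - yx on the
right, so the hypothesis would give x = 1; hence S is directly finite.

Let ac + bd = 1. Zorn's lemma and injectivity give y and a maximal submodule D on which u = a + by
is injective. Let X be maximal among submodules meeting u(D) trivially. If ker u and X had nonzero
isomorphic cyclic submodules, changing y on ker u would enlarge D
(`Module.Baer.injective_of_maximal`). Let T invert u on u(D) and kill X. By this orthogonality T is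
injective on W = P + TP + T²P + ..., where P = ker u, while its range meets P trivially. Direct
finiteness then forces P = 0 (`Module.Baer.eq_zero_of_injective_on`), so u is a unit.

For vector spaces, a shift of an infinite basis violates direct finiteness; in finite dimension,
splitting off idempotents enlarges the space of fixed vectors until an idempotent remains. -/

theorem isProductOfIdempotents_of_isIdempotentElem {S : Type*} [Ring S] {e : S}
    (he : IsIdempotentElem e) : IsProductOfIdempotents e :=
  ⟨[e], by simpa using he, by simp⟩

theorem IsProductOfIdempotents.mul {S : Type*} [Ring S] {a b : S}
    (ha : IsProductOfIdempotents a) (hb : IsProductOfIdempotents b) :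
    IsProductOfIdempotents (a * b) := by
  obtain ⟨l, hl, rfl⟩ := ha
  obtain ⟨l', hl', rfl⟩ := hb
  refine ⟨l ++ l', fun e he => ?_, by simp⟩
  rcases List.mem_append.1 he with h | h
  · exact hl e h
  · exact hl' e h

/-- A right invertible product of idempotents is `1`. -/
theorem IsProductOfIdempotents.eq_one_of_mul_eq_one {S : Type*} [Ring S] {a b : S}
    (ha : IsProductOfIdempotents a) (hab : a * b = 1) : a = 1 := by
  obtain ⟨l, hl, rfl⟩ := ha
  induction l generalizing b with
  | nil => simp
  | cons e l ih =>
    have hee : e * e = e := hl e (by simp)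
    rw [List.prod_cons, mul_assoc] at hab
    have he : e = 1 := by
      calc e = e * (e * (l.prod * b)) := by rw [hab, mul_one]
        _ = e * (l.prod * b) := by rw [← mul_assoc, hee]
        _ = 1 := hab
    subst he
    rw [List.prod_cons, one_mul]
    exact ih (fun e he => hl e (by simp [he])) (by simpa using hab)

theorem isDedekindFiniteMonoid_of_isProductOfIdempotents {S : Type*} [Ring S]
    (h : ∀ s : S, IsRightSingular s → IsProductOfIdempotents s) :
    IsDedekindFiniteMonoid S where
  mul_eq_one_symm {x y} hxy := by
    by_contra hyx
    have hx : IsRightSingular x :=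
      ⟨1 - y * x, sub_ne_zero.2 (Ne.symm hyx), by
        rw [mul_sub, ← mul_assoc, hxy, mul_one, one_mul, sub_self]⟩
    have h1 := (h x hx).eq_one_of_mul_eq_one hxy
    subst h1
    exact hyx (by simpa using hxy)

end IdempotentProducts

/-! ### Directly finite injective modules. -/

section Injective

variable {A : Type*} [Ring A] {M : Type*} [AddCommGroup M] [Module A M]

/-- There is a submodule that is maximal among those in which only `0` satisfies `p`. -/
theorem Submodule.exists_maximal_avoiding {N : Type*} [AddCommGroup N] [Module A N]
    (p : N → Prop) :
    ∃ C : Submodule A N, (∀ x ∈ C, p x → x = 0) ∧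
      ∀ C' : Submodule A N, C ≤ C' → (∀ x ∈ C', p x → x = 0) → C' ≤ C := by
  obtain ⟨C, -, hC⟩ := zorn_le_nonempty₀ {C : Submodule A N | ∀ x ∈ C, p x → x = 0}
    (fun c hc hchain y hy => by
      refine ⟨sSup c, fun x hx hpx => ?_, fun z hz => le_sSup hz⟩
      obtain ⟨D, hD, hxD⟩ := (Submodule.mem_sSup_of_directed ⟨y, hy⟩ hchain.directedOn).1 hx
      exact hc hD x hxD hpx) ⊥ (fun x hx _ => by simpa using hx)
  exact ⟨C, hC.prop, fun C' hle h => hC.le_of_ge h hle⟩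

/-- A maximal submodule `X` meeting `W` trivially forms an essential sum with `W`. -/
theorem Submodule.exists_smul_eq_add_of_maximal {W X : Submodule A M}
    (hX : ∀ x ∈ X, x ∈ W → x = 0)
    (hmax : ∀ C' : Submodule A M, X ≤ C' → (∀ x ∈ C', x ∈ W → x = 0) → C' ≤ X)
    {m : M} (hm : m ≠ 0) : ∃ r : A, r • m ≠ 0 ∧ ∃ w ∈ W, ∃ x ∈ X, r • m = w + x := by
  by_contra! h
  have key : ∀ (r : A) (w : M), w ∈ W → ∀ x ∈ X, r • m = w + x → r • m = 0 := by
    intro r w hw x hx e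
    by_contra hr
    exact h r hr w hw x hx e
  have hmX : m ∈ X := by
    refine hmax (X ⊔ Submodule.span A {m}) le_sup_left (fun y hy hyW => ?_)
      (Submodule.mem_sup_right (Submodule.mem_span_singleton_self m))
    obtain ⟨x, hx, n, hn, rfl⟩ := Submodule.mem_sup.1 hy
    obtain ⟨r, rfl⟩ := Submodule.mem_span_singleton.1 hn
    have hr := key r (x + r • m) hyW (-x) (X.neg_mem hx) (by abel)
    rw [hr, add_zero] at hyW ⊢
    exact hX x hx hyW
  exact hm (by simpa using key 1 0 W.zero_mem m hmX (by simp))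

/-- A map into an injective module extends along any map whose kernel it kills. -/
theorem Module.Baer.exists_comp_eq_of_ker_le (hM : Module.Baer A M) {N N' : Type*}
    [AddCommGroup N] [Module A N] [AddCommGroup N'] [Module A N'] (f : N →ₗ[A] N')
    (g : N →ₗ[A] M) (h : ∀ x, f x = 0 → g x = 0) : ∃ t : N' →ₗ[A] M, ∀ x, t (f x) = g x := by
  have hle : LinearMap.ker f ≤ LinearMap.ker g := fun x hx => h x hx
  obtain ⟨t, ht⟩ := hM.extension_property
    ((LinearMap.ker f).liftQ f le_rfl) (LinearMap.ker_eq_bot.1 (Submodule.ker_liftQ_eq_bot _ _ _ le_rfl))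
    ((LinearMap.ker f).liftQ g hle)
  exact ⟨t, fun x => by simpa using LinearMap.congr_fun ht ((LinearMap.ker f).mkQ x)⟩

/-- Extending the identity along `g` yields a left inverse, which direct finiteness makes two-sided.
-/
theorem Module.Baer.isUnit_of_injective [IsDedekindFiniteMonoid (Module.End A M)]
    (hM : Module.Baer A M) {g : Module.End A M} (hg : ∀ m, g m = 0 → m = 0) :
    ∃ h : Module.End A M, h * g = 1 ∧ g * h = 1 := by
  obtain ⟨h, hh⟩ := hM.exists_comp_eq_of_ker_le g LinearMap.id (by simpa using hg)
  have h1 : h * g = 1 := LinearMap.ext fun x => by simpa using hh x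
  exact ⟨h, h1, mul_eq_one_symm h1⟩

/-- In a directly finite injective module `M`, an endomorphism that is injective on an invariant
submodule `W` cannot miss a nonzero submodule of `W`. -/
theorem Module.Baer.eq_zero_of_injective_on [IsDedekindFiniteMonoid (Module.End A M)]
    (hM : Module.Baer A M) {T : Module.End A M} {W P : Submodule A M}
    (hinj : ∀ w ∈ W, T w = 0 → w = 0) (hTW : ∀ w ∈ W, T w ∈ W) (hPW : P ≤ W)
    (hP : ∀ m, T m ∈ P → T m = 0) : ∀ q ∈ P, q = 0 := by
  obtain ⟨Z, hZ, hmax⟩ := Submodule.exists_maximal_avoiding (A := A) (fun x : M => x ∈ W)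
  -- `g` is `T` on `W` and the identity on `Z`. Since `W + Z` is essential and `T` maps `W` to
  -- itself, `g` is injective, hence a unit.
  obtain ⟨g, hg⟩ := hM.exists_comp_eq_of_ker_le (W.subtype.coprod Z.subtype)
    ((T ∘ₗ W.subtype).coprod Z.subtype) (by
      rintro ⟨⟨w, hw⟩, ⟨z, hz⟩⟩ h
      simp only [LinearMap.coprod_apply, Submodule.subtype_apply, LinearMap.comp_apply] at h ⊢
      have hzw : z = -w := eq_neg_of_add_eq_zero_right h
      have hz0 : z = 0 := hZ z hz (hzw ▸ W.neg_mem hw)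
      subst hz0
      rw [add_zero] at h
      simp [h])
  have hg' : ∀ w ∈ W, ∀ z ∈ Z, g (w + z) = T w + z := fun w hw z hz => by
    simpa using hg (⟨w, hw⟩, ⟨z, hz⟩)
  obtain ⟨h, hhg, hgh⟩ := hM.isUnit_of_injective (g := g) (by
    intro m hm
    by_contra hm0
    obtain ⟨r, hr, w, hw, z, hz, e⟩ := Submodule.exists_smul_eq_add_of_maximal hZ hmax hm0
    have h0 : T w + z = 0 := by rw [← hg' w hw z hz, ← e, map_smul, hm, smul_zero]
    have hz0 : z = 0 := hZ z hz (eq_neg_of_add_eq_zero_right h0 ▸ W.neg_mem (hTW w hw))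
    subst hz0
    rw [add_zero] at h0 e
    exact hr (e.trans (hinj w hw h0)))
  intro q hq
  by_contra hq0
  have hgq : g (h q) = q := LinearMap.congr_fun hgh q
  have hhq : h q ≠ 0 := fun h0 => hq0 (by rw [← hgq, h0, map_zero])
  -- A nonzero multiple of the preimage `h q` is `w + z`. Its image `T w + z` lies in `P ≤ W`, so `z
  -- = 0`, and then `T w ∈ P` vanishes.
  obtain ⟨r, hr, w, hw, z, hz, e⟩ := Submodule.exists_smul_eq_add_of_maximal hZ hmax hhq
  have h1 : r • q = T w + z := by rw [← hg' w hw z hz, ← e, map_smul, hgq]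
  have hz0 : z = 0 := hZ z hz (by
    rw [show z = r • q - T w by rw [h1]; abel]
    exact W.sub_mem (W.smul_mem r (hPW hq)) (hTW w hw))
  subst hz0
  rw [add_zero] at h1
  have h2 : r • q = 0 := by
    rw [h1]
    exact hP w (h1 ▸ P.smul_mem r hq)
  exact hr (by rw [← map_smul, h2, map_zero])

/-- `L` and `X` are orthogonal: they have no nonzero isomorphic cyclic submodules. -/
def Submodule.AnnihilatorOrthogonal (L X : Submodule A M) : Prop :=
  ∀ l ∈ L, ∀ x ∈ X, (∀ r : A, r • l = 0 ↔ r • x = 0) → x = 0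

theorem Submodule.AnnihilatorOrthogonal.eq_zero {L X : Submodule A M}
    (h : L.AnnihilatorOrthogonal X) {x : M} (hL : x ∈ L) (hX : x ∈ X) : x = 0 :=
  h x hL x hX fun _ => Iff.rfl

/-- Orthogonality to the kernel of `T` passes from `L` and `P` to the direct sum `P + T L`. -/
theorem Submodule.AnnihilatorOrthogonal.sup_map {P L : Submodule A M} {T : Module.End A M}
    (hP : P.AnnihilatorOrthogonal (LinearMap.ker T))
    (hL : L.AnnihilatorOrthogonal (LinearMap.ker T))
    (hPT : ∀ m, T m ∈ P → T m = 0) :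
    (P ⊔ L.map T).AnnihilatorOrthogonal (LinearMap.ker T) := by
  intro l hl x hx h
  obtain ⟨q, hq, t, ht, rfl⟩ := Submodule.mem_sup.1 hl
  obtain ⟨w, hw, rfl⟩ := Submodule.mem_map.1 ht
  have hsum : ∀ r : A, r • (q + T w) = 0 ↔ r • q = 0 ∧ r • w = 0 := by
    intro r
    rw [smul_add]
    constructor
    · intro e
      have h1 : T (r • w) = 0 := hPT _ (by
        rw [map_smul, eq_neg_of_add_eq_zero_right e]
        exact P.neg_mem (P.smul_mem r hq))
      rw [← map_smul, h1, add_zero] at e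
      exact ⟨e, hL.eq_zero (L.smul_mem r hw) h1⟩
    · rintro ⟨h1, h2⟩
      rw [h1, ← map_smul, h2, map_zero, add_zero]
  -- It suffices that `q` and `x` have equal annihilators. If `r` kills `q`, then `r • w` and `r •
  -- x` have equal annihilators, and `hL` gives `r • x = 0`.
  refine hP q hq x hx fun r => ⟨fun hr => ?_, fun hr => ((hsum r).1 ((h r).2 hr)).1⟩
  refine hL (r • w) (L.smul_mem r hw) (r • x) (Submodule.smul_mem _ r hx) fun s => ?_
  rw [← mul_smul, ← mul_smul, ← h (s * r), hsum]
  exact ⟨fun e => ⟨by rw [mul_smul, hr, smul_zero], e⟩, fun e => e.2⟩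

/-- In a directly finite injective module, a submodule that meets the range of `T` trivially and is
orthogonal to the kernel of `T` vanishes. -/
theorem Module.Baer.eq_zero_of_annihilatorOrthogonal
    [IsDedekindFiniteMonoid (Module.End A M)] (hM : Module.Baer A M) {T : Module.End A M}
    {P : Submodule A M} (hP : P.AnnihilatorOrthogonal (LinearMap.ker T))
    (hPT : ∀ m, T m ∈ P → T m = 0) : ∀ q ∈ P, q = 0 := by
  let F : Submodule A M → Submodule A M := fun L => P ⊔ L.map T
  have hF : Monotone F := fun L L' h => sup_le_sup_left (Submodule.map_mono h) _
  -- The partial sums of P + TP + T²P + ..., starting from the empty sum.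
  let W : ℕ → Submodule A M := fun n => F^[n] ⊥
  have hWs : ∀ n, W (n + 1) = P ⊔ (W n).map T := fun n => Function.iterate_succ_apply' F n ⊥
  have hW : Monotone W := hF.monotone_iterate_of_le_map bot_le
  have hmem : ∀ x, x ∈ ⨆ n, W n ↔ ∃ n, x ∈ W n := fun x =>
    Submodule.mem_iSup_of_directed W hW.directed_le
  have horth : ∀ n, (W n).AnnihilatorOrthogonal (LinearMap.ker T) := by
    intro n
    induction n with
    | zero =>
      intro l hl x _ h
      have hl0 : l = 0 := hl
      simpa using (h 1).1 (by simp [hl0])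
    | succ n ih => exact (hWs n).symm ▸ hP.sup_map ih hPT
  refine hM.eq_zero_of_injective_on (T := T) (W := ⨆ n, W n) ?_ ?_ ?_ hPT
  · intro w hw h
    obtain ⟨n, hn⟩ := (hmem w).1 hw
    exact (horth n).eq_zero hn h
  · intro w hw
    obtain ⟨n, hn⟩ := (hmem w).1 hw
    refine (hmem _).2 ⟨n + 1, ?_⟩
    rw [hWs]
    exact Submodule.mem_sup_right (Submodule.mem_map_of_mem hn)
  · intro x hx
    refine (hmem _).2 ⟨1, ?_⟩
    rw [hWs]
    exact Submodule.mem_sup_left hx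

end Injective

/-! ### Stable range one for endomorphism rings. -/

section StableRange

variable {A : Type*} [Ring A] {M : Type*} [AddCommGroup M] [Module A M]

/-- Among the submodules `D` and endomorphisms `y` such that `a + b * y` is injective on `D`, there
is a maximal pair. -/
theorem Module.Baer.exists_maximal_injective_on (hM : Module.Baer A M) (a b : Module.End A M) :
    ∃ (y : Module.End A M) (D : Submodule A M), (∀ v ∈ D, (a + b * y) v = 0 → v = 0) ∧
      ∀ y' : Module.End A M, (∀ v ∈ D, y' v = y v) → ∀ m : M,
        (∀ v ∈ D, ∀ r : A, (a + b * y') (v + r • m) = 0 → v + r • m = 0) → m ∈ D := by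
  -- `C` is the graph of a partial map: avoiding `z.1 = 0` makes it single-valued, and avoiding `a
  -- z.1 + b z.2 = 0` makes `a + b * y` injective on its domain.
  obtain ⟨C, hC, hmax⟩ := Submodule.exists_maximal_avoiding (A := A)
    (fun z : M × M => z.1 = 0 ∨ a z.1 + b z.2 = 0)
  obtain ⟨y, hy⟩ := hM.exists_comp_eq_of_ker_le (LinearMap.fst A M M ∘ₗ C.subtype)
    (LinearMap.snd A M M ∘ₗ C.subtype) (by
      rintro ⟨z, hz⟩ h
      have := hC z hz (Or.inl h)
      simp [this])
  have hy' : ∀ z ∈ C, y z.1 = z.2 := fun z hz => hy ⟨z, hz⟩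
  refine ⟨y, C.map (LinearMap.fst A M M), ?_, ?_⟩
  · rintro _ ⟨z, hz, rfl⟩ h
    have h0 := hC z hz (Or.inr (by simpa [hy' z hz] using h))
    simp [h0]
  · intro y' hyy' m hinj
    let E : Submodule A M := C.map (LinearMap.fst A M M) ⊔ Submodule.span A {m}
    have hmE : m ∈ E := Submodule.mem_sup_right (Submodule.mem_span_singleton_self m)
    have hle : E.map (LinearMap.id.prod y') ≤ C := by
      refine hmax _ (fun z hz => ?_) ?_
      · have h1 : z.1 ∈ C.map (LinearMap.fst A M M) := ⟨z, hz, rfl⟩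
        exact ⟨z.1, Submodule.mem_sup_left h1,
          Prod.ext rfl ((hyy' z.1 h1).trans (hy' z hz))⟩
      · rintro _ ⟨e, he, rfl⟩ h
        have he0 : e = 0 := by
          rcases h with h | h
          · exact h
          · obtain ⟨v, hv, n, hn, rfl⟩ := Submodule.mem_sup.1 he
            obtain ⟨r, rfl⟩ := Submodule.mem_span_singleton.1 hn
            exact hinj v hv r h
        rw [he0, map_zero]
    exact ⟨_, hle ⟨m, hmE, rfl⟩, rfl⟩

/-- If `u` is injective on `D` and this cannot be improved by adding to `u` a map `b * z` with `z`
vanishing on `D`, then `u` is injective. -/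
theorem Module.Baer.injective_of_maximal [IsDedekindFiniteMonoid (Module.End A M)]
    (hM : Module.Baer A M) {u b c d : Module.End A M} (hcd : u * c + b * d = 1)
    {D : Submodule A M} (hD : ∀ v ∈ D, u v = 0 → v = 0)
    (hmax : ∀ z : Module.End A M, (∀ v ∈ D, z v = 0) → ∀ m : M,
      (∀ v ∈ D, ∀ r : A, (u + b * z) (v + r • m) = 0 → v + r • m = 0) → m ∈ D) :
    ∀ m, u m = 0 → m = 0 := by
  have hcd' : ∀ x, u (c x) + b (d x) = x := fun x => LinearMap.congr_fun hcd x
  -- `D + ker u` is essential in `M`; this is the maximality of `D` for `z = 0`.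
  have hess : ∀ m : M, m ≠ 0 → ∃ r : A, r • m ≠ 0 ∧ ∃ v ∈ D, u (r • m - v) = 0 := by
    intro m hm
    by_contra! h
    have hmD : m ∈ D := by
      refine hmax 0 (fun _ _ => rfl) m fun v hv r e => ?_
      rw [mul_zero, add_zero] at e
      have hr : r • m = 0 := by
        by_contra hr
        exact h r hr (-v) (D.neg_mem hv) (by rwa [sub_neg_eq_add, add_comm])
      rw [hr, add_zero] at e ⊢
      exact hD v hv e
    exact h 1 (by simpa using hm) m hmD (by simp)
  obtain ⟨X, hX, hXmax⟩ :=
    Submodule.exists_maximal_avoiding (A := A) (fun x : M => x ∈ D.map u)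
  obtain ⟨T, hT⟩ := hM.exists_comp_eq_of_ker_le ((u ∘ₗ D.subtype).coprod X.subtype)
    (D.subtype.coprod 0) (by
      rintro ⟨⟨v, hv⟩, ⟨x, hx⟩⟩ h
      simp only [LinearMap.coprod_apply, Submodule.subtype_apply, LinearMap.comp_apply] at h ⊢
      have hx0 : x = 0 := hX x hx (by
        rw [eq_neg_of_add_eq_zero_right h]
        exact Submodule.neg_mem _ (Submodule.mem_map_of_mem hv))
      subst hx0
      rw [add_zero] at h
      simp [hD v hv h])
  have hTu : ∀ v ∈ D, T (u v) = v := fun v hv => by simpa using hT (⟨v, hv⟩, 0)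
  have hTX : ∀ x ∈ X, T x = 0 := fun x hx => by simpa using hT (0, ⟨x, hx⟩)
  have hker : LinearMap.ker T ≤ X := by
    refine hXmax _ hTX ?_
    rintro _ hx ⟨v, hv, rfl⟩
    rw [LinearMap.mem_ker, hTu v hv] at hx
    rw [hx, map_zero]
  have hPT : ∀ m, T m ∈ LinearMap.ker u → T m = 0 := by
    intro m hm
    refine hTX m (hXmax ((LinearMap.ker u).comap T) (fun x hx => ?_) ?_ hm)
    · simp [hTX x hx]
    · rintro _ hx ⟨v, hv, rfl⟩
      simpa [hTu v hv] using hx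
  refine hM.eq_zero_of_annihilatorOrthogonal (T := T) (P := LinearMap.ker u) ?_ hPT
  intro q hq x hx h
  replace hx := hker hx
  rw [LinearMap.mem_ker] at hq
  by_contra hx0
  -- After multiplication by `s`, `c x` agrees with an element of `D` modulo `ker u`, so that `b (d
  -- (s • x)) = s • x - u v₁`.
  obtain ⟨s, hs, v₁, hv₁, hv₁'⟩ : ∃ s : A, s • x ≠ 0 ∧ ∃ v ∈ D, u (s • c x - v) = 0 := by
    by_cases hc : c x = 0
    · exact ⟨1, by simpa using hx0, 0, D.zero_mem, by simp [hc]⟩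
    · obtain ⟨s, hs, v, hv, e⟩ := hess _ hc
      exact ⟨s, fun h0 => hs (by rw [← map_smul, h0, map_zero]), v, hv, e⟩
  have hDq : ∀ v ∈ D, ∀ r : A, v + r • s • q = 0 → v = 0 ∧ r • s • x = 0 := by
    intro v hv r e
    have h1 : v = 0 := hD v hv (by simpa [hq] using congrArg u e)
    rw [h1, zero_add, ← mul_smul] at e
    exact ⟨h1, by rw [← mul_smul]; exact (h _).1 e⟩
  -- With `z` zero on `D` and `z (s • q) = d (s • x)`, the map `u + b * z` sends `s • q` to `s • x`
  -- modulo `u(D)`. As `X` meets `u(D)` trivially, it is injective on `D + A s q`, so maximality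
  -- puts `s • q` in `D`, where `u` has no kernel.
  obtain ⟨z, hz⟩ := hM.exists_comp_eq_of_ker_le
    (D.subtype.coprod (LinearMap.toSpanSingleton A M (s • q)))
    ((0 : D →ₗ[A] M).coprod (LinearMap.toSpanSingleton A M (d (s • x)))) (by
      rintro ⟨⟨v, hv⟩, r⟩ e
      have h2 := (hDq v hv r (by simpa using e)).2
      have h3 : r • d (s • x) = 0 := by rw [← map_smul, h2, map_zero]
      simpa using h3)
  have hzD : ∀ v ∈ D, z v = 0 := fun v hv => by simpa using hz (⟨v, hv⟩, 0)
  have hzq : z (s • q) = d (s • x) := by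
    have := hz (0, 1)
    simpa only [LinearMap.coprod_apply, map_zero, zero_add, LinearMap.toSpanSingleton_apply,
      one_smul] using this
  have hbd : b (d (s • x)) = s • x - u v₁ := by
    have h1 := hcd' (s • x)
    rw [map_smul c, ← sub_add_cancel (s • c x) v₁, map_add, hv₁', zero_add] at h1
    rw [eq_sub_iff_add_eq, add_comm]
    exact h1
  have hmem : s • q ∈ D := by
    refine hmax z hzD (s • q) fun v hv r e => ?_
    have e' : u v + r • (s • x - u v₁) = 0 := by
      rw [← hbd, ← hzq]
      simpa [hq, hzD v hv] using e
    have hr : r • s • x = 0 := by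
      refine hX _ (X.smul_mem _ (X.smul_mem _ hx)) ⟨r • v₁ - v, D.sub_mem (D.smul_mem r hv₁) hv, ?_⟩
      rw [map_sub, map_smul, sub_eq_iff_eq_add, eq_comm, ← sub_eq_zero, ← e', smul_sub]
      abel
    have hrq : r • s • q = 0 := by
      rw [← mul_smul] at hr ⊢
      exact (h _).2 hr
    rw [hrq, add_zero] at e ⊢
    refine hD v hv ?_
    simpa [hzD v hv] using e
  have := (hDq _ hmem (-1) (by simp)).2
  exact hs (by simpa using this)

/-- The endomorphism ring of a directly finite injective module has stable range `1`. -/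
theorem Module.Baer.hasStableRangeOne_end [IsDedekindFiniteMonoid (Module.End A M)]
    (hM : Module.Baer A M) : HasStableRangeOne (Module.End A M) := by
  rintro a b ⟨c, d, hcd⟩
  obtain ⟨y, D, hD, hmax⟩ := hM.exists_maximal_injective_on a b
  have hu : ∀ m, (a + b * y) m = 0 → m = 0 := by
    -- The correction `- y * c` in `d` offsets the passage from `a` to `a + b * y`.
    refine hM.injective_of_maximal (b := b) (c := c) (d := d - y * c) ?_ hD
      fun z hz m h => hmax (y + z) (fun v hv => by simp [hz v hv]) m ?_
    · rw [← hcd]; noncomm_ring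
    · rwa [mul_add, ← add_assoc]
  obtain ⟨h, h1, h2⟩ := hM.isUnit_of_injective hu
  exact ⟨y, ⟨⟨a + b * y, h, h2, h1⟩, rfl⟩⟩

end StableRange

/-! ### Singular endomorphisms of vector spaces. -/

section VectorSpace

variable {K : Type*} [Field K] {V : Type*} [AddCommGroup V] [Module K V]

/-- The fixed vectors of an endomorphism. -/
def Module.End.fixedVectors (s : Module.End K V) : Submodule K V :=
  LinearMap.eqLocus s LinearMap.id

theorem Module.End.mem_fixedVectors {s : Module.End K V} {v : V} :
    v ∈ s.fixedVectors ↔ s v = v := Iff.rfl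

/-- Changing `s` on a vector `k` of its kernel amounts to splitting off an idempotent factor. -/
theorem Module.End.eq_add_smulRight_mul {s : Module.End K V} {k : V} (hk : s k = 0)
    {φ : Module.Dual K V} (hφ : φ k = 1) (w : V) :
    IsIdempotentElem (1 - φ.smulRight k : Module.End K V) ∧
      (s + φ.smulRight w) * (1 - φ.smulRight k) = s := by
  constructor
  · refine LinearMap.ext fun v => ?_
    simp [hφ]
  · refine LinearMap.ext fun v => ?_
    simp [hφ, hk]

/-- Keeps a modified endomorphism singular when the modification does not enlarge the range. -/
theorem Module.End.exists_ne_zero_of_range_le [FiniteDimensional K V] {s t : Module.End K V}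
    (h : LinearMap.range t ≤ LinearMap.range s) (hs : ∃ v, v ≠ 0 ∧ s v = 0) :
    ∃ v, v ≠ 0 ∧ t v = 0 := by
  by_contra! ht
  have ht' : LinearMap.ker t = ⊥ := (LinearMap.ker_eq_bot').2 fun v hv => by
    by_contra hv0
    exact ht v hv0 hv
  have hs' : LinearMap.ker s = ⊥ := LinearMap.ker_eq_bot_iff_range_eq_top.2
    (top_le_iff.1 ((LinearMap.ker_eq_bot_iff_range_eq_top.1 ht') ▸ h))
  obtain ⟨v, hv, hv'⟩ := hs
  exact hv ((LinearMap.ker_eq_bot').1 hs' v hv')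

theorem Submodule.exists_dual_eq_one {F : Submodule K V} {k : V} (hk : k ∉ F) :
    ∃ φ : Module.Dual K V, φ k = 1 ∧ ∀ v ∈ F, φ v = 0 := by
  obtain ⟨φ, hφ, hF⟩ := Submodule.exists_le_ker_of_notMem hk
  refine ⟨(φ k)⁻¹ • φ, by simp [hφ], fun v hv => ?_⟩
  have : φ v = 0 := hF hv
  simp [this]

/-- A vector common to the kernel and the range of `s` allows one to write `s` as a singular
endomorphism with more fixed vectors times an idempotent. -/
theorem Module.End.exists_fixedVectors_lt [FiniteDimensional K V] {s : Module.End K V} {k : V}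
    (hk0 : k ≠ 0) (hk : s k = 0) (hkr : k ∈ LinearMap.range s) :
    ∃ t e : Module.End K V, IsIdempotentElem e ∧ t * e = s ∧ (∃ v, v ≠ 0 ∧ t v = 0) ∧
      s.fixedVectors < t.fixedVectors := by
  have hkF : k ∉ s.fixedVectors := fun h => hk0 ((mem_fixedVectors.1 h).symm.trans hk)
  obtain ⟨φ, hφ, hF⟩ := Submodule.exists_dual_eq_one hkF
  obtain ⟨he, hmul⟩ := eq_add_smulRight_mul hk hφ k
  refine ⟨s + φ.smulRight k, _, he, hmul, exists_ne_zero_of_range_le ?_ ⟨k, hk0, hk⟩, ?_⟩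
  · rintro _ ⟨v, rfl⟩
    exact Submodule.add_mem _ ⟨v, rfl⟩ (Submodule.smul_mem _ _ hkr)
  · refine lt_of_le_of_ne (fun v hv => ?_) fun h => hkF (h ▸ ?_)
    · simpa [mem_fixedVectors, hF v hv] using hv
    · simp [mem_fixedVectors, hφ, hk]

/-- Induction on the fixed space, which can only grow finitely often. If kernel and range share a
nonzero vector, it can be made fixed. Otherwise, unless `s` is idempotent, one change on a kernel
vector creates such a shared vector and keeps all fixed vectors. -/
theorem Module.End.isProductOfIdempotents_of_singular [FiniteDimensional K V]
    (s : Module.End K V) (hs : ∃ v, v ≠ 0 ∧ s v = 0) : IsProductOfIdempotents s := by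
  obtain ⟨F, hF⟩ : ∃ F, F = s.fixedVectors := ⟨_, rfl⟩
  induction F using WellFoundedGT.induction generalizing s with
  | ind F ih =>
  subst hF
  have step : ∀ t : Module.End K V, s.fixedVectors ≤ t.fixedVectors →
      ∀ k, k ≠ 0 → t k = 0 → k ∈ LinearMap.range t → IsProductOfIdempotents t := by
    intro t hst k hk0 hk hkr
    obtain ⟨t', e, he, rfl, ht', hlt⟩ := exists_fixedVectors_lt hk0 hk hkr
    exact (ih _ (hst.trans_lt hlt) t' ht' rfl).mul (isProductOfIdempotents_of_isIdempotentElem he)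
  by_cases hid : s * s = s
  · exact isProductOfIdempotents_of_isIdempotentElem hid
  by_cases hkr : ∃ k, k ≠ 0 ∧ s k = 0 ∧ k ∈ LinearMap.range s
  · obtain ⟨k, hk0, hk, hk'⟩ := hkr
    exact step s le_rfl k hk0 hk hk'
  have hdisj : ∀ v, s (s v) = 0 → s v = 0 := by
    intro v hv
    by_contra h
    exact hkr ⟨s v, h, hv, v, rfl⟩
  obtain ⟨v₀, hv₀⟩ : ∃ v, s (s v) ≠ s v := by
    by_contra! h
    exact hid (LinearMap.ext h)
  obtain ⟨k, hk0, hk⟩ := hs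
  -- This provides `φ` zero on fixed vectors with `φ k = 1` and `φ (s v₀) = -1`. Redirecting `k` to
  -- `s (s v₀)` then makes the new map kill `s v₀`, which stays in its range.
  have hkF : k ∉ s.fixedVectors ⊔ Submodule.span K {k + s v₀} := by
    intro h
    obtain ⟨f, hf, n, hn, e⟩ := Submodule.mem_sup.1 h
    obtain ⟨γ, rfl⟩ := Submodule.mem_span_singleton.1 hn
    have hf' : f = (1 - γ) • k - γ • s v₀ := by
      rw [← sub_eq_iff_eq_add.2 e.symm, smul_add, sub_smul, one_smul]
      abel
    have hsf : s f = -(γ • s (s v₀)) := by simp [hf', hk]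
    have hfix : f = s f := (mem_fixedVectors.1 hf).symm
    have h1 : (1 - γ) • k = γ • s v₀ - γ • s (s v₀) := by
      rw [hsf, hf'] at hfix
      rw [sub_eq_iff_eq_add.1 hfix]
      abel
    have h2 : (1 - γ) • k = 0 := by
      have h3 := hdisj (γ • v₀ - γ • s v₀) (by
        rw [map_sub, map_smul, map_smul, ← h1, map_smul, hk, smul_zero])
      rw [h1]
      simpa using h3
    have hγ : γ = 1 := by
      rcases smul_eq_zero.1 h2 with h | h
      · exact (sub_eq_zero.1 h).symm
      · exact absurd h hk0
    rw [h2, hγ, one_smul, one_smul, eq_comm, sub_eq_zero] at h1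
    exact hv₀ h1.symm
  obtain ⟨φ, hφ, hF⟩ := Submodule.exists_dual_eq_one hkF
  have hφt : φ (s v₀) = -1 := by
    have := hF _ (Submodule.mem_sup_right (Submodule.mem_span_singleton_self _))
    rw [map_add, hφ] at this
    exact eq_neg_of_add_eq_zero_right this
  obtain ⟨he, hmul⟩ := eq_add_smulRight_mul hk hφ (s (s v₀))
  rw [← hmul]
  refine (step (s + φ.smulRight (s (s v₀))) (fun v hv => ?_) (s v₀) ?_ ?_ ?_).mul
    (isProductOfIdempotents_of_isIdempotentElem he)
  · simpa [mem_fixedVectors, hF v (Submodule.mem_sup_left hv)] using hv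
  · intro h
    exact hv₀ (by rw [h, map_zero])
  · simp [hφt]
  · exact ⟨v₀ - φ v₀ • k, by simp [hφ, hk]⟩

/-- A vector space whose endomorphism ring is directly finite is finite-dimensional. -/
theorem Module.End.finiteDimensional_of_isDedekindFiniteMonoid
    [IsDedekindFiniteMonoid (Module.End K V)] : FiniteDimensional K V := by
  by_contra hfin
  let B := Module.Basis.ofVectorSpace K V
  have hinf : Infinite (Module.Basis.ofVectorSpaceIndex K V) := by
    by_contra h
    have := not_infinite_iff_finite.1 h
    exact hfin (Module.Finite.of_basis B)
  -- An infinite index set absorbs one more point; the resulting injective shift of the basis misses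
  -- `σ none`, so its left inverse is not a right inverse.
  obtain ⟨σ⟩ : Nonempty (Option (Module.Basis.ofVectorSpaceIndex K V) ≃
      Module.Basis.ofVectorSpaceIndex K V) := by
    rw [← Cardinal.eq, Cardinal.mk_option]
    exact Cardinal.add_one_eq (Cardinal.aleph0_le_mk _)
  let f : Module.Basis.ofVectorSpaceIndex K V → Module.Basis.ofVectorSpaceIndex K V :=
    fun i => σ (some i)
  have hf : Function.Injective f := fun i j h => Option.some_injective _ (σ.injective h)
  have : Nonempty (Module.Basis.ofVectorSpaceIndex K V) := ⟨σ none⟩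
  have hxy : B.constr K (fun i => B (Function.invFun f i)) * B.constr K (fun i => B (f i)) =
      (1 : Module.End K V) :=
    B.ext fun i => by simp [Module.Basis.constr_basis, Function.leftInverse_invFun hf i]
  have hyx := LinearMap.congr_fun (mul_eq_one_symm hxy) (B (σ none))
  rw [Module.End.mul_apply, Module.Basis.constr_basis, Module.Basis.constr_basis,
    Module.End.one_apply] at hyx
  exact Option.some_ne_none _ (σ.injective (B.injective hyx))

end VectorSpace

/-- A right `R`-module is a module over `Rᵐᵒᵖ`, and the right ideals of `R` are the left ideals of
`Rᵐᵒᵖ`. So `Module.Baer Rᵐᵒᵖ M` says that `M` is injective as a right `R`-module: every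
homomorphism from a right ideal of `R` to `M` extends to `R`. -/
theorem mainTheorem6 :
    (∀ (R : Type u) [Ring R] (M : Type v) [AddCommGroup M] [Module Rᵐᵒᵖ M],
      Module.Baer Rᵐᵒᵖ M →
      (∀ s : Module.End Rᵐᵒᵖ M, IsRightSingular s → IsProductOfIdempotents s) →
      HasStableRangeOne (Module.End Rᵐᵒᵖ M)) ∧
    (∀ (K : Type w) [Field K] (V : Type x) [AddCommGroup V] [Module K V],
      (∀ s : Module.End K V, IsRightSingular s → IsProductOfIdempotents s) ↔
      FiniteDimensional K V) := by
  refine ⟨fun R _ M _ _ hM h => ?_, fun K _ V _ _ => ⟨fun h => ?_, fun _ s hs => ?_⟩⟩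
  · have := isDedekindFiniteMonoid_of_isProductOfIdempotents h
    exact hM.hasStableRangeOne_end
  · have := isDedekindFiniteMonoid_of_isProductOfIdempotents h
    exact Module.End.finiteDimensional_of_isDedekindFiniteMonoid
  · obtain ⟨y, hy, hsy⟩ := hs
    obtain ⟨v, hv⟩ : ∃ v, y v ≠ 0 := by
      by_contra! h
      exact hy (LinearMap.ext h)
    exact s.isProductOfIdempotents_of_singular ⟨y v, hv, LinearMap.congr_fun hsy v⟩
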